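/- Let $\omega=\{0,1,2,\dots\}$, let ${}^{<\omega}\omega$ and ${}^{\omega}\omega$ be the sets of finite and infinite strings over $\omega$, and write $p\!\upharpoonright\! n$ for the prefix of length $n$ of $p\in{}^{\omega}\omega$. A *tree* is a set $T\subseteq{}^{<\omega}\omega$ that contains the empty string and is closed under initial segments; $[T]$ is the set of $p\in{}^{\omega}\omega$ with $p\!\upharpoonright\! n\in T$ for all $n$. For $\mathcal V\subseteq\mathcal P(\omega)$ upward closed under $\subseteq$, a tree $T$ is *$\mathcal V$-branching* if $\{n\in\omega\mid \sigma^\smallfrown n\in T\}\in\mathcal V$ for every $\sigma\in T$. A *partial continuous function* $\Phi:\subseteq{}^{\omega}\omega\to\omega$ is a partial function for which there is a partial function $\varphi:\subseteq{}^{<\omega}\omega\to\omega$ such that $\varphi(\sigma)=\varphi(\tau)$ whenever $\sigma,\tau\in\mathrm{dom}(\varphi)$ and $\sigma$ is a prefix of $\tau$, and such that, for all $p$ and $c$: $p\in\mathrm{dom}(\Phi)$ and $\Phi(p)=c$ if and only if there is $n$ with $p\!\upharpoonright\! n\in\mathrm{dom}(\varphi)$ and $\varphi(p\!\upharpoonright\!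 n)=c$. For upward closed families $\mathcal U,\mathcal V\subseteq\mathcal P(\omega)$, write $\mathcal U\leq_{\mathrm{LT}}^{\mathsf o}\mathcal V$ (the *Gamified Katětov order*) if there is a partial continuous function $\Phi:\subseteq{}^{\omega}\omega\to\omega$ such that for every $A\in\mathcal U$ there is a $\mathcal V$-branching tree $T$ with $[T]\subseteq\mathrm{dom}(\Phi)$ and $\Phi(p)\in A$ for all $p\in[T]$. For downward closed families (in particular ideals) $\mathcal I,\mathcal J\subseteq\mathcal P(\omega)$, write $\mathcal I\leq_{\mathrm{LT}}^{\mathsf o}\mathcal J$ if $\mathcal I^*\leq_{\mathrm{LT}}^{\mathsf o}\mathcal J^*$, where $\mathcal I^*=\{A\subseteq\omega\mid\omega\setminus A\in\mathcal I\}$. Let $$\mathrm{Sum}_{1/n}=\Big\{A\subseteq\omega\ \Big|\ \sum_{n\in A}\tfrac1{n+1}<\infty\Big\}$$ be the canonical summable ideal and $$\mathcal H=\{A\subseteq\omega\mid \mathrm{FS}(B)\not\subseteq A\text{ for every infinite }B\subseteq\omega\}$$ the Hindman ideal, where $\mathrm{FS}(B)=\{\sum_{n\in F}n\mid F\subseteq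 B\text{ finite and non-empty}\}$. **Theorem.** $\mathrm{Sum}_{1/n}$ and $\mathcal H$ are incomparable in the Gamified Katětov order, that is, $$\mathrm{Sum}_{1/n}\not\leq_{\mathrm{LT}}^{\mathsf o}\mathcal H\qquad\text{and}\qquad\mathcal H\not\leq_{\mathrm{LT}}^{\mathsf o}\mathrm{Sum}_{1/n}.$$ -/

import Mathlib

namespace GamifiedKatetov

/-- The prefix `(p 0, …, p (n - 1))` of length `n` of an infinite string `p`. -/
def initSeg (p : ℕ → ℕ) (n : ℕ) : List ℕ := (List.range n).map p

/-- A partial function on infinite strings is (partial) continuous if it is induced by a coherent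
partial function `φ` on finite strings. -/
def IsPartialContinuous (Φ : (ℕ → ℕ) →. ℕ) : Prop :=
  ∃ φ : List ℕ →. ℕ,
    (∀ (σ τ : List ℕ) (c d : ℕ), c ∈ φ σ → d ∈ φ τ → σ <+: τ → c = d) ∧
    ∀ (p : ℕ → ℕ) (c : ℕ), c ∈ Φ p ↔ ∃ n : ℕ, c ∈ φ (initSeg p n)

/-- A tree of finite strings: it contains the root and is closed under initial segments. -/
structure IsTree (T : Set (List ℕ)) : Prop where
  root_mem : [] ∈ T
  mem_of_prefix : ∀ σ τ : List ℕ, τ <+: σ → σ ∈ T → τ ∈ T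

/-- The set `[T]` of infinite paths through `T`. -/
def paths (T : Set (List ℕ)) : Set (ℕ → ℕ) := {p | ∀ n : ℕ, initSeg p n ∈ T}

/-- A `V`-branching tree: at every node, the set of immediate successors belongs to `V`. -/
structure IsBranchingTree (V : UpperSet (Set ℕ)) (T : Set (List ℕ)) : Prop where
  isTree : IsTree T
  branching : ∀ σ ∈ T, {n : ℕ | σ ++ [n] ∈ T} ∈ V

/-- The Gamified Katětov order on upper sets. -/
def UpperLE (U V : UpperSet (Set ℕ)) : Prop :=
  ∃ Φ : (ℕ → ℕ) →. ℕ, IsPartialContinuous Φ ∧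
    ∀ A ∈ U, ∃ T : Set (List ℕ), IsBranchingTree V T ∧
      paths T ⊆ Φ.Dom ∧ ∀ p ∈ paths T, ∀ c ∈ Φ p, c ∈ A

/-- The dual upper set `{A | ω \ A ∈ I}` of a lower set `I`. -/
def dual (I : LowerSet (Set ℕ)) : UpperSet (Set ℕ) where
  carrier := {A | Aᶜ ∈ I}
  upper' := fun _ _ hAB hA => I.lower (Set.compl_subset_compl.mpr hAB) hA

/-- The Gamified Katětov order on lower sets, in particular on ideals. -/
def LowerLE (I J : LowerSet (Set ℕ)) : Prop := UpperLE (dual I) (dual J)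

/-- The canonical summable ideal: the sets `A` with `∑_{n ∈ A} 1 / (n + 1) < ∞`. -/
def canonicalSummableIdeal : LowerSet (Set ℕ) where
  carrier := {A | Summable fun n : A => 1 / (((n : ℕ) : ℝ) + 1)}
  lower' := by
    intro A B hBA hA
    have h : Summable fun n : A => 1 / (((n : ℕ) : ℝ) + 1) := hA
    exact h.comp_injective (i := Set.inclusion hBA) (Set.inclusion_injective hBA)

/-- The set of sums of non-empty finite sets of (distinct) elements of `A`. -/
def finiteSums (A : Set ℕ) : Set ℕ :=
  {x | ∃ F : Finset ℕ, F.Nonempty ∧ (F : Set ℕ) ⊆ A ∧ x = ∑ n ∈ F, n}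

/-- The Hindman ideal: the sets that contain `finiteSums B` for no infinite `B`. -/
def hindmanIdeal : LowerSet (Set ℕ) where
  carrier := {A | ∀ B : Set ℕ, B.Infinite → ¬ finiteSums B ⊆ A}
  lower' := fun _ _ hCA hA B hB h => hA B hB (h.trans hCA)

end GamifiedKatetov

namespace GamifiedKatetov

open Filter Topology MeasureTheory
open scoped ENNReal

attribute [local instance] Ultrafilter.add

/-! ### Paths, bars and winning strategies -/

/-! To refute `I ≤ J`, take any candidate `φ` and build a well-founded tree of strings, branching
over `J`-positive sets, whose leaf values form a set `S ∈ I`. Such a tree meets every `dual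
J`-branching tree, so no such tree forces values into `Sᶜ`. The tree is built from the leaves to the
root by bar induction along an ultrafilter extending `dual J`, attaching to each string a limit of
its possible values.

For `J` Hindman, the ultrafilter is a free idempotent and limits live in `ℕ∞`: a finite limit means
a single value suffices, and `⊤` means value sets of arbitrarily small harmonic measure suffice. The
inductive step is a Galvin–Glazer construction that also bounds the measure of the values met on the
finite sums (`IsFreeIdempotent.exists_finiteSums_subset`).

For `J` summable, the limits live in the compact space `ℤ_[2]`. Free idempotents converge 2-adically
to `0`, so infinitely many small sets may be united if they converge to a point
(`isTranslateSmall_iUnion`). Finite blocks of children of growing mass, with values ever closer to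
the limit, then form a positive set. -/

theorem initSeg_succ (p : ℕ → ℕ) (n : ℕ) : initSeg p (n + 1) = initSeg p n ++ [p n] := by
  simp [initSeg, List.range_succ]

theorem initSeg_prefix (p : ℕ → ℕ) {m n : ℕ} (h : m ≤ n) : initSeg p m <+: initSeg p n := by
  induction n, h using Nat.le_induction with
  | base => exact List.prefix_rfl
  | succ n _ ih =>
    rw [initSeg_succ]
    exact ih.trans (List.prefix_append _ _)

theorem initSeg_length_of_extends (σ : List ℕ) (q : ℕ → ℕ) :
    initSeg (fun i => if h : i < σ.length then σ[i] else q (i - σ.length)) σ.length = σ := by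
  apply List.ext_getElem
  · simp [initSeg]
  · intro i h₁ h₂
    simp [initSeg, h₂]

/-- A property that passes from each string to some immediate extension holds along a path. -/
theorem exists_path_of_forall_exists_append {Q : List ℕ → Prop} {σ : List ℕ} (hσ : Q σ)
    (hQ : ∀ τ, Q τ → ∃ n, Q (τ ++ [n])) :
    ∃ p : ℕ → ℕ, initSeg p σ.length = σ ∧ ∀ k, Q (initSeg p (σ.length + k)) := by
  choose! next hnext using hQ
  let s : ℕ → List ℕ := fun k => Nat.rec σ (fun _ τ => τ ++ [next τ]) k
  have hs : ∀ k, Q (s k) := by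
    intro k
    induction k with
    | zero => exact hσ
    | succ k ih => exact hnext _ ih
  let p : ℕ → ℕ := fun i => if h : i < σ.length then σ[i] else next (s (i - σ.length))
  have hp : ∀ k, initSeg p (σ.length + k) = s k := by
    intro k
    induction k with
    | zero => exact initSeg_length_of_extends σ (fun i => next (s i))
    | succ k ih =>
      rw [← add_assoc, initSeg_succ, ih]
      simp [p, s]
  exact ⟨p, hp 0, fun k => hp k ▸ hs k⟩

/-- Bar induction along a filter. -/
theorem bar_induction {φ : List ℕ →. ℕ} {T : Set (List ℕ)} {q : Filter ℕ} {G : List ℕ → Prop}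
    (hroot : [] ∈ T) (hT : ∀ σ ∈ T, ∀ᶠ n in q, σ ++ [n] ∈ T)
    (hbar : ∀ p ∈ paths T, ∃ n c, c ∈ φ (initSeg p n))
    (hleaf : ∀ σ c, c ∈ φ σ → G σ) (hnode : ∀ σ, (∀ᶠ n in q, G (σ ++ [n])) → G σ) : G [] := by
  by_contra hG
  obtain ⟨p, -, hp⟩ := exists_path_of_forall_exists_append (Q := fun σ => σ ∈ T ∧ ¬ G σ)
    (σ := []) ⟨hroot, hG⟩ (by
      rintro σ ⟨hσ, hGσ⟩
      have h : ∃ᶠ n in q, ¬ G (σ ++ [n]) := fun h => hGσ (hnode σ (by simpa using h))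
      obtain ⟨n, hn, hn'⟩ := (h.and_eventually (hT σ hσ)).exists
      exact ⟨n, hn', hn⟩)
  simp only [List.length_nil, zero_add] at hp
  obtain ⟨n, c, hc⟩ := hbar p fun n => (hp n).1
  exact (hp n).2 (hleaf _ c hc)

/-- From the string `σ` there is a well-founded `J`-positively branching tree of extensions all of
whose leaves have a `φ`-value in `S`. -/
inductive Wins (J : LowerSet (Set ℕ)) (φ : List ℕ →. ℕ) (S : Set ℕ) : List ℕ → Prop
  | leaf (σ : List ℕ) (c : ℕ) (hc : c ∈ φ σ) (hS : c ∈ S) : Wins J φ S σ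
  | node (σ : List ℕ) (A : Set ℕ) (hA : A ∉ J) (h : ∀ n ∈ A, Wins J φ S (σ ++ [n])) : Wins J φ S σ

variable {I J : LowerSet (Set ℕ)} {φ : List ℕ →. ℕ} {S S' : Set ℕ} {σ : List ℕ}

theorem Wins.mono (h : Wins J φ S σ) (hS : S ⊆ S') : Wins J φ S' σ := by
  induction h with
  | leaf σ c hc hcS => exact .leaf σ c hc (hS hcS)
  | node σ A hA _ ih => exact .node σ A hA ih

/-- A `J`-positive set meets every set in `dual J`, so one can descend inside both trees to a leaf;
`univ ∉ J` lets the path continue in `T` beyond it. -/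
theorem Wins.exists_path {T : Set (List ℕ)} (hJ : Set.univ ∉ J) (h : Wins J φ S σ)
    (hT : IsBranchingTree (dual J) T) (hσ : σ ∈ T) : ∃ p ∈ paths T, ∃ n, ∃ c ∈ S, c ∈ φ (initSeg p n) := by
  have key : ∀ τ ∈ T, ∀ A ∉ J, ∃ n ∈ A, τ ++ [n] ∈ T := by
    intro τ hτ A hA
    by_contra! hcon
    exact hA (J.lower (fun n hn => hcon n hn) (hT.branching τ hτ))
  induction h with
  | leaf σ c hc hcS =>
    obtain ⟨p, hp, hpT⟩ := exists_path_of_forall_exists_append (Q := (· ∈ T)) hσ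
      fun τ hτ => (key τ hτ _ hJ).imp fun _ h => h.2
    refine ⟨p, fun n => ?_, σ.length, c, hcS, by rwa [hp]⟩
    exact hT.isTree.mem_of_prefix _ _ (initSeg_prefix p (Nat.le_add_left n σ.length)) (hpT n)
  | node σ A hA _ ih =>
    obtain ⟨n, hn, hnT⟩ := key σ hσ A hA
    exact ih n hn hnT

/-- A criterion for `I` not to be below `J`: a filter `q` extending the dual of `J` and a property
of strings that holds at leaves, passes from `q`-many children to the parent, and at the root
yields a winning strategy for a set in `I`. -/
theorem not_lowerLE_of_bar (hI : ∅ ∈ I) (hJ : Set.univ ∉ J) (q : Filter ℕ)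
    (hq : ∀ A : Set ℕ, Aᶜ ∈ J → A ∈ q) (G : (List ℕ →. ℕ) → List ℕ → Prop)
    (hleaf : ∀ φ σ c, c ∈ φ σ → G φ σ)
    (hnode : ∀ φ σ, (∀ᶠ n in q, G φ (σ ++ [n])) → G φ σ)
    (hroot : ∀ φ, G φ [] → ∃ S ∈ I, Wins J φ S []) : ¬ LowerLE I J := by
  rintro ⟨Φ, ⟨φ, -, hφ⟩, hΦ⟩
  -- The target `univ` is used only to obtain a tree barred by the domain of `φ`.
  obtain ⟨T, hT, hdom, -⟩ := hΦ Set.univ (show Set.univᶜ ∈ I by simpa using hI)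
  obtain ⟨S, hS, hW⟩ := hroot φ <| bar_induction (q := q) hT.isTree.root_mem
    (fun σ hσ => hq _ (hT.branching σ hσ))
    (fun p hp => by
      obtain ⟨c, hc⟩ := Part.dom_iff_mem.1 (hdom hp)
      obtain ⟨n, hn⟩ := (hφ p c).1 hc
      exact ⟨n, c, hn⟩)
    (hleaf φ) (hnode φ)
  obtain ⟨T', hT', -, hA⟩ := hΦ Sᶜ (show Sᶜᶜ ∈ I by simpa using hS)
  obtain ⟨p, hp, n, c, hcS, hc⟩ := hW.exists_path hJ hT' hT'.isTree.root_mem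
  exact hA p hp c ((hφ p c).2 ⟨n, hc⟩) hcS

/-! ### The harmonic measure -/

/-- The measure on `ℕ` giving `n` the mass `1 / (n + 1)`. -/
noncomputable def harmonicMeasure : Measure ℕ :=
  Measure.sum fun n : ℕ => ((n : ℝ≥0∞) + 1)⁻¹ • Measure.dirac n

theorem harmonicMeasure_apply (A : Set ℕ) :
    harmonicMeasure A = ∑' n : A, (((n : ℕ) : ℝ≥0∞) + 1)⁻¹ := by
  rw [harmonicMeasure, Measure.sum_apply _ (MeasurableSet.of_discrete),
    tsum_subtype A fun n : ℕ => ((n : ℝ≥0∞) + 1)⁻¹]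
  refine tsum_congr fun n => ?_
  by_cases h : n ∈ A <;> simp [h]

theorem mem_canonicalSummableIdeal_iff {A : Set ℕ} :
    A ∈ canonicalSummableIdeal ↔ harmonicMeasure A < ∞ := by
  rw [harmonicMeasure_apply, lt_top_iff_ne_top]
  have h : ∀ n : A, (((n : ℕ) : ℝ≥0∞) + 1)⁻¹
      = ((1 / (((n : ℕ) : NNReal) + 1) : NNReal) : ℝ≥0∞) := by
    intro n
    rw [one_div, ENNReal.coe_inv (by positivity)]
    push_cast
    rfl
  simp_rw [h]
  rw [ENNReal.tsum_coe_ne_top_iff_summable, ← NNReal.summable_coe]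
  push_cast
  rfl

theorem harmonicMeasure_univ : harmonicMeasure Set.univ = ∞ := by
  by_contra h
  have hs := mem_canonicalSummableIdeal_iff.2 (lt_top_iff_ne_top.2 h)
  have hs' : Summable fun n : (Set.univ : Set ℕ) => 1 / (((n : ℕ) : ℝ) + 1) := hs
  have h2 : Summable fun n : ℕ => 1 / ((n : ℝ) + 1) :=
    (Equiv.Set.univ ℕ).symm.summable_iff.2 hs'
  apply Real.not_summable_one_div_natCast
  rw [← summable_nat_add_iff 1]
  simpa using h2

theorem harmonicMeasure_singleton (n : ℕ) : harmonicMeasure {n} = ((n : ℝ≥0∞) + 1)⁻¹ := by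
  rw [harmonicMeasure_apply, tsum_subtype {n} fun n : ℕ => ((n : ℝ≥0∞) + 1)⁻¹,
    tsum_eq_single n] <;> simp +contextual

theorem harmonicMeasure_setOf_coe_eq_le (N : ℕ) (w : ℕ∞) :
    harmonicMeasure {v : ℕ | N < v ∧ (v : ℕ∞) = w} ≤ ((N : ℝ≥0∞) + 1)⁻¹ := by
  by_cases h : ∃ v : ℕ, N < v ∧ (v : ℕ∞) = w
  · obtain ⟨v, hv, rfl⟩ := h
    calc _ ≤ harmonicMeasure {v} := measure_mono fun u hu => by simpa using hu.2
      _ ≤ _ := by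
        rw [harmonicMeasure_singleton]
        gcongr
  · rw [show {v : ℕ | N < v ∧ (v : ℕ∞) = w} = ∅ by
      ext v
      simpa using fun h₁ h₂ => h ⟨v, h₁, h₂⟩]
    simp

theorem exists_finset_le_harmonicMeasure {A : Set ℕ} (hA : harmonicMeasure A = ∞) (k : ℕ) :
    ∃ F : Finset ℕ, (F : Set ℕ) ⊆ A ∧ (k : ℝ≥0∞) ≤ harmonicMeasure F := by
  have hU : A = ⋃ n : ℕ, A ∩ Set.Iio n := by
    ext x
    simp only [Set.mem_iUnion, Set.mem_inter_iff, Set.mem_Iio]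
    exact ⟨fun h => ⟨x + 1, h, Nat.lt_succ_self x⟩, fun ⟨_, h, _⟩ => h⟩
  have hmono : Monotone fun n : ℕ => A ∩ Set.Iio n := fun m n h =>
    Set.inter_subset_inter_right _ (Set.Iio_subset_Iio h)
  rw [hU, hmono.measure_iUnion] at hA
  obtain ⟨n, hn⟩ := lt_iSup_iff.1 (hA ▸ ENNReal.natCast_lt_top k)
  have hfin : (A ∩ Set.Iio n).Finite := (Set.finite_Iio n).inter_of_right A
  exact ⟨hfin.toFinset, by simp, by simpa using hn.le⟩

/-! ### Idempotent ultrafilters and finite sums -/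

/-- A non-principal idempotent ultrafilter on `ℕ`. -/
structure IsFreeIdempotent (q : Ultrafilter ℕ) : Prop where
  add_self : q + q = q
  ne_zero : ∀ᶠ n in (q : Filter ℕ), n ≠ 0

theorem IsFreeIdempotent.eventually_iff {q : Ultrafilter ℕ} (hq : IsFreeIdempotent q)
    {P : ℕ → Prop} :
    (∀ᶠ n in (q : Filter ℕ), P n) ↔
      ∀ᶠ m in (q : Filter ℕ), ∀ᶠ n in (q : Filter ℕ), P (m + n) := by
  conv_lhs => rw [← hq.add_self]
  exact Ultrafilter.eventually_add q q P

theorem IsFreeIdempotent.eventually_ne {q : Ultrafilter ℕ} (hq : IsFreeIdempotent q) (d : ℕ) :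
    ∀ᶠ n in (q : Filter ℕ), n ≠ d := by
  by_contra h
  have hd : ∀ᶠ n in (q : Filter ℕ), n = d := by
    simpa using Ultrafilter.frequently_iff_eventually.1 h
  obtain ⟨m, hm, hmd, hm0⟩ := ((hq.eventually_iff.1 hd).and (hd.and hq.ne_zero)).exists
  -- Here `m`, `n` and `m + n` all equal `d`, forcing `m = 0`.
  obtain ⟨n, hn, hnd⟩ := (hm.and hd).exists
  omega

theorem IsFreeIdempotent.eventually_gt {q : Ultrafilter ℕ} (hq : IsFreeIdempotent q) (d : ℕ) :
    ∀ᶠ n in (q : Filter ℕ), d < n := by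
  have h : ∀ᶠ n in (q : Filter ℕ), ∀ i ∈ Finset.range (d + 1), n ≠ i :=
    (Finset.eventually_all _).2 fun i _ => hq.eventually_ne i
  filter_upwards [h] with n hn
  by_contra hlt
  exact hn n (by simp; omega) rfl

theorem exists_sum_of_mem_FS (a : Stream' ℕ) (m : ℕ) (hm : m ∈ Hindman.FS a)
    (ha : Function.Injective a.get) :
    ∃ F : Finset ℕ, F.Nonempty ∧ (F : Set ℕ) ⊆ Set.range a.get ∧ m = ∑ n ∈ F, n := by
  have htail : ∀ a : Stream' ℕ, Set.range a.tail.get ⊆ Set.range a.get := by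
    rintro a _ ⟨n, rfl⟩
    exact ⟨n + 1, rfl⟩
  have hinj : ∀ a : Stream' ℕ, Function.Injective a.get → Function.Injective a.tail.get :=
    fun a ha i j h => Nat.succ_injective (ha h)
  induction hm with
  | head' a => exact ⟨{a.head}, by simp, by simp, by simp⟩
  | tail' a m _ ih =>
    obtain ⟨F, hF, hFa, rfl⟩ := ih (hinj a ha)
    exact ⟨F, hF, hFa.trans (htail a), rfl⟩
  | cons' a m _ ih =>
    obtain ⟨F, hF, hFa, rfl⟩ := ih (hinj a ha)
    have hnot : a.head ∉ F := by
      intro h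
      obtain ⟨n, hn⟩ := hFa h
      exact absurd (ha (show a.get (n + 1) = a.get 0 from hn)) (by simp)
    refine ⟨insert a.head F, by simp, ?_, by rw [Finset.sum_insert hnot]⟩
    rw [Finset.coe_insert, Set.insert_subset_iff]
    exact ⟨⟨0, rfl⟩, hFa.trans (htail a)⟩

/-- The finite sums of an infinite set are large for some non-principal idempotent ultrafilter. -/
theorem exists_isFreeIdempotent {B : Set ℕ} (hB : B.Infinite) :
    ∃ q : Ultrafilter ℕ, IsFreeIdempotent q ∧ finiteSums B ∈ q := by
  -- Without `0` every finite sum is non-zero, which keeps the idempotent free.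
  have hB' : (B \ {0}).Infinite := hB.sdiff (Set.finite_singleton 0)
  let e := hB'.natEmbedding
  let a : Stream' ℕ := fun n => (e n : ℕ)
  have ha : Function.Injective a.get := fun i j h => e.injective (Subtype.ext h)
  have hsub : ∀ m ∈ Hindman.FS a, m ≠ 0 ∧ m ∈ finiteSums B := by
    intro m hm
    obtain ⟨F, hF, hFa, rfl⟩ := exists_sum_of_mem_FS a m hm ha
    have hFB : (F : Set ℕ) ⊆ B \ {0} := by
      intro x hx
      obtain ⟨n, rfl⟩ := hFa hx
      exact (e n).2
    refine ⟨?_, F, hF, hFB.trans Set.sdiff_subset, rfl⟩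
    obtain ⟨x, hx⟩ := hF
    exact fun h0 => (hFB hx).2 (Finset.sum_eq_zero_iff.1 h0 x hx)
  obtain ⟨q, hq, hqa⟩ := Hindman.exists_idempotent_ultrafilter_le_FS a
  exact ⟨q, ⟨hq, hqa.mono fun m hm => (hsub m hm).1⟩, hqa.mono fun m hm => (hsub m hm).2⟩

/-! ### The summable ideal is not below the Hindman ideal -/

/-- If no finite value is taken `q`-often, then `q` avoids any finitely many of them, so `f` tends
to `⊤`. -/
theorem exists_ultralimit (q : Ultrafilter ℕ) (f : ℕ → ℕ∞) :
    ∃ v : ℕ∞, ∀ N : ℕ, ∀ᶠ n in (q : Filter ℕ), f n = v ∨ (v = ⊤ ∧ (N : ℕ∞) < f n) := by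
  by_cases h : ∃ c : ℕ, ∀ᶠ n in (q : Filter ℕ), f n = c
  · obtain ⟨c, hc⟩ := h
    exact ⟨c, fun N => hc.mono fun n hn => Or.inl hn⟩
  · refine ⟨⊤, fun N => ?_⟩
    have h' : ∀ᶠ n in (q : Filter ℕ), ∀ i ∈ Finset.range (N + 1), f n ≠ (i : ℕ∞) :=
      (Finset.eventually_all _).2 fun i _ =>
        Ultrafilter.eventually_not.2 fun hi => h ⟨i, hi⟩
    filter_upwards [h'] with n hn
    refine Or.inr ⟨rfl, ?_⟩
    by_contra! hle
    obtain ⟨c, hc⟩ := ENat.ne_top_iff_exists.1 (ne_top_of_le_ne_top (ENat.natCast_ne_top N) hle)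
    rw [← hc, Nat.cast_le] at hle
    exact hn c (by simp; omega) hc.symm

/-- If `X n` collects the sums of subsets of `{b 0, …, b (n - 1)}`, then the sum of a finite set `F`
of values of `b` lies in some `X n` and, when `F` is non-empty, splits off a last summand. -/
theorem sum_mem_of_subset_image {b : ℕ → ℕ} {X : ℕ → Finset ℕ} (h0 : 0 ∈ X 0)
    (hX : ∀ n, X (n + 1) = X n ∪ (X n).image (· + b n)) (n : ℕ) (F : Finset ℕ)
    (hF : (F : Set ℕ) ⊆ b '' Set.Iio n) :
    ∑ i ∈ F, i ∈ X n ∧ (F.Nonempty → ∃ j, ∃ x ∈ X j, ∑ i ∈ F, i = x + b j) := by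
  induction n generalizing F with
  | zero =>
    have : F = ∅ := by simpa using hF
    simp [this, h0]
  | succ n ih =>
    by_cases hn : b n ∈ F
    · have hE : ((F.erase (b n) : Finset ℕ) : Set ℕ) ⊆ b '' Set.Iio n := by
        intro y hy
        rw [Finset.coe_erase] at hy
        obtain ⟨i, hi, rfl⟩ := hF hy.1
        refine ⟨i, ?_, rfl⟩
        have hin : i ≠ n := fun h => hy.2 (by simp [h])
        simp only [Set.mem_Iio] at hi ⊢
        omega
      have hsum := Finset.sum_erase_add F (fun i => i) hn
      have hmem := (ih _ hE).1
      refine ⟨?_, fun _ => ⟨n, _, hmem, hsum.symm⟩⟩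
      rw [hX, Finset.mem_union, Finset.mem_image]
      exact Or.inr ⟨_, hmem, hsum⟩
    · have hE : (F : Set ℕ) ⊆ b '' Set.Iio n := by
        intro y hy
        obtain ⟨i, hi, rfl⟩ := hF hy
        refine ⟨i, ?_, rfl⟩
        have hin : i ≠ n := fun h => hn (h ▸ hy)
        simp only [Set.mem_Iio] at hi ⊢
        omega
      refine ⟨?_, (ih _ hE).2⟩
      rw [hX, Finset.mem_union]
      exact Or.inl (ih _ hE).1

/-- If `f` tends to infinity along a non-principal idempotent ultrafilter, then each large set
contains the finite sums of an infinite set on which the finite values of `f` have small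
harmonic measure. -/
theorem IsFreeIdempotent.exists_finiteSums_subset {q : Ultrafilter ℕ} (hq : IsFreeIdempotent q)
    {A : Set ℕ} (hA : A ∈ q) (f : ℕ → ℕ∞)
    (hf : ∀ N : ℕ, ∀ᶠ n in (q : Filter ℕ), (N : ℕ∞) < f n) {ε : ℝ≥0∞} (hε : ε ≠ 0) :
    ∃ B : Set ℕ, B.Infinite ∧ finiteSums B ⊆ A ∧
      harmonicMeasure {v : ℕ | ∃ x ∈ finiteSums B, f x = v} ≤ ε := by
  -- `l x` is the limit of `f (x + y)` as `y` tends to `q`. By idempotency `l (x + b)` also tends to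
  -- `l x`.
  choose l hl using fun x => exists_ultralimit q fun y => f (x + y)
  have hl0 : l 0 = ⊤ := by
    by_contra h
    obtain ⟨c, hc⟩ := ENat.ne_top_iff_exists.1 h
    obtain ⟨n, hn, hn'⟩ := ((hl 0 0).and (hf c)).exists
    simp only [zero_add, h, false_and, or_false] at hn
    rw [hn, hc] at hn'
    exact lt_irrefl _ hn'
  have hladd : ∀ x (N : ℕ), ∀ᶠ b in (q : Filter ℕ), l (x + b) = l x ∨ (N : ℕ∞) < l (x + b) := by
    intro x N
    filter_upwards [hq.eventually_iff.1 (hl x N)] with b hb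
    by_cases htop : l (x + b) = ⊤
    · exact Or.inr (htop ▸ ENat.natCast_lt_top N)
    · obtain ⟨y, hy, hy'⟩ := (hb.and (hl (x + b) N)).exists
      simp only [htop, false_and, or_false] at hy'
      rw [← add_assoc, hy'] at hy
      exact hy.imp_right And.right
  let Inv : ℕ → Prop := fun x => ∀ᶠ y in (q : Filter ℕ), x + y ∈ A
  have hInv : ∀ x, Inv x → ∀ᶠ b in (q : Filter ℕ), Inv (x + b) := by
    intro x hx
    filter_upwards [hq.eventually_iff.1 hx] with b hb
    simpa only [Inv, add_assoc] using hb
  obtain ⟨δ, hδ, hδε⟩ := ENNReal.exists_pos_sum_of_countable' hε ℕ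
  -- A sum `x ∈ X` can create two new finite values, `f (x + b)` and `l (x + b)`, each of mass at
  -- most `1 / (N + 1)`; hence the factor 2.
  have hN : ∀ (n : ℕ) (X : Finset ℕ), ∃ N : ℕ, X.card * (2 * ((N : ℝ≥0∞) + 1)⁻¹) ≤ δ n := by
    intro n X
    have ht : Tendsto (fun N : ℕ => (X.card : ℝ≥0∞) * (2 * (((N + 1 : ℕ) : ℝ≥0∞))⁻¹)) atTop
        (𝓝 (X.card * (2 * 0))) := by
      refine ENNReal.Tendsto.const_mul (ENNReal.Tendsto.const_mul ?_ (by simp)) (by simp)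
      exact ENNReal.tendsto_inv_nat_nhds_zero.comp (tendsto_add_atTop_nat 1)
    obtain ⟨N, hN⟩ := (ht.eventually_lt_const (u := δ n) (by simpa using hδ n)).exists
    exact ⟨N, by simpa using hN.le⟩
  choose N hN using hN
  have hb : ∀ (n : ℕ) (X : Finset ℕ), ∃ b, 0 < b ∧ (∀ x ∈ X, x < b) ∧ ∀ x ∈ X,
      (Inv x → Inv (x + b) ∧ x + b ∈ A) ∧
      (f (x + b) = l x ∨ (N n X : ℕ∞) < f (x + b)) ∧
      (l (x + b) = l x ∨ (N n X : ℕ∞) < l (x + b)) := by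
    intro n X
    have hX : ∀ᶠ b in (q : Filter ℕ), ∀ x ∈ X, x < b ∧ (Inv x → Inv (x + b) ∧ x + b ∈ A) ∧
      (f (x + b) = l x ∨ (N n X : ℕ∞) < f (x + b)) ∧
      (l (x + b) = l x ∨ (N n X : ℕ∞) < l (x + b)) := by
      refine (Finset.eventually_all X).2 fun x _ => ?_
      have h1 : ∀ᶠ b in (q : Filter ℕ), Inv x → Inv (x + b) ∧ x + b ∈ A := by
        by_cases hx : Inv x
        · filter_upwards [hInv x hx, hx] with b h1 h2 _ using ⟨h1, h2⟩
        · exact Eventually.of_forall fun _ h => absurd h hx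
      filter_upwards [hq.eventually_gt x, h1, hl x (N n X), hladd x (N n X)] with b h1 h2 h3 h4
      exact ⟨h1, h2, h3.imp_right And.right, h4⟩
    obtain ⟨b, hb, hb0⟩ := (hX.and (hq.eventually_gt 0)).exists
    exact ⟨b, hb0, fun x hx => (hb x hx).1, fun x hx => (hb x hx).2⟩
  choose g hg0 hgt hg using hb
  let X : ℕ → Finset ℕ := fun n => Nat.rec {0} (fun n Y => Y ∪ Y.image (· + g n Y)) n
  let b : ℕ → ℕ := fun n => g n (X n)
  have hX : ∀ n, X (n + 1) = X n ∪ (X n).image (· + b n) := fun n => rfl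
  have h0 : ∀ n, 0 ∈ X n := by
    intro n
    induction n with
    | zero => simp [X]
    | succ n ih => rw [hX]; exact Finset.mem_union_left _ ih
  have hbmono : StrictMono b := by
    refine strictMono_nat_of_lt_succ fun n => hgt (n + 1) _ _ ?_
    rw [hX, Finset.mem_union, Finset.mem_image]
    exact Or.inr ⟨0, h0 n, zero_add _⟩
  let W : ℕ → Set ℕ := fun n => ⋃ x ∈ X n,
    ({v : ℕ | N n (X n) < v ∧ (v : ℕ∞) = f (x + b n)} ∪
      {v : ℕ | N n (X n) < v ∧ (v : ℕ∞) = l (x + b n)})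
  have hW : harmonicMeasure (⋃ n, W n) ≤ ε := by
    refine (measure_iUnion_le _).trans ((ENNReal.tsum_le_tsum fun n => ?_).trans hδε.le)
    refine ((measure_biUnion_finset_le _ _).trans ?_).trans (hN n (X n))
    rw [← nsmul_eq_mul]
    refine Finset.sum_le_card_nsmul _ _ _ fun x _ => ?_
    rw [two_mul]
    exact (measure_union_le _ _).trans (add_le_add (harmonicMeasure_setOf_coe_eq_le _ _)
      (harmonicMeasure_setOf_coe_eq_le _ _))
  -- As `l 0 = ⊤`, every finite value of `l` on a sum was new at some stage and so is counted in
  -- some `W n`.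
  have hXinv : ∀ n, ∀ x ∈ X n, Inv x ∧ ∀ v : ℕ, l x = v → v ∈ ⋃ n, W n := by
    intro n
    induction n with
    | zero =>
      intro x hx
      obtain rfl : x = 0 := by simpa [X] using hx
      refine ⟨?_, fun v hv => ?_⟩
      · simp only [Inv, zero_add]
        exact hA
      · rw [hl0] at hv
        exact absurd hv.symm (ENat.natCast_ne_top v)
    | succ n ih =>
      intro y hy
      rw [hX, Finset.mem_union, Finset.mem_image] at hy
      obtain hy | ⟨x, hx, rfl⟩ := hy
      · exact ih y hy
      · refine ⟨((hg n _ x hx).1 (ih x hx).1).1, fun v hv => ?_⟩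
        obtain h | h := (hg n _ x hx).2.2
        · exact (ih x hx).2 v (h ▸ hv)
        · have hlt : N n (X n) < v := by
            have h' := h.trans_eq hv
            exact_mod_cast h'
          exact Set.mem_iUnion.2 ⟨n, Set.mem_iUnion₂.2 ⟨x, hx, Or.inr ⟨hlt, hv.symm⟩⟩⟩
  have hsum : ∀ s ∈ finiteSums (Set.range b), ∃ j, ∃ x ∈ X j, s = x + b j := by
    rintro _ ⟨F, hF, hFb, rfl⟩
    have hsub : (F : Set ℕ) ⊆ b '' Set.Iio (F.sup id + 1) := by
      intro y hy
      obtain ⟨i, rfl⟩ := hFb hy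
      refine ⟨i, ?_, rfl⟩
      have h1 : b i ≤ F.sup id := Finset.le_sup (f := id) hy
      exact Nat.lt_succ_of_le ((hbmono.id_le i).trans h1)
    exact (sum_mem_of_subset_image (h0 0) hX _ F hsub).2 hF
  refine ⟨Set.range b, Set.infinite_range_of_injective hbmono.injective, ?_, ?_⟩
  · intro s hs
    obtain ⟨j, x, hx, rfl⟩ := hsum s hs
    exact ((hg j _ x hx).1 (hXinv j x hx).1).2
  · refine (measure_mono ?_).trans hW
    rintro v ⟨s, hs, hv⟩
    obtain ⟨j, x, hx, rfl⟩ := hsum s hs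
    obtain h | h := (hg j _ x hx).2.1
    · exact (hXinv j x hx).2 v (h ▸ hv)
    · have hlt : N j (X j) < v := by
        have h' := h.trans_eq hv
        exact_mod_cast h'
      exact Set.mem_iUnion.2 ⟨j, Set.mem_iUnion₂.2 ⟨x, hx, Or.inl ⟨hlt, hv.symm⟩⟩⟩

theorem IsFreeIdempotent.notMem_hindmanIdeal {q : Ultrafilter ℕ} (hq : IsFreeIdempotent q)
    {A : Set ℕ} (hA : A ∈ q) : A ∉ hindmanIdeal := by
  obtain ⟨B, hB, hBA, -⟩ := hq.exists_finiteSums_subset hA (fun _ => ⊤)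
    (fun N => Eventually.of_forall fun _ => ENat.natCast_lt_top N) one_ne_zero
  exact fun h => h B hB hBA

theorem IsFreeIdempotent.mem_of_compl_mem_hindmanIdeal {q : Ultrafilter ℕ}
    (hq : IsFreeIdempotent q) {A : Set ℕ} (hA : Aᶜ ∈ hindmanIdeal) : A ∈ q := by
  by_contra h
  exact hq.notMem_hindmanIdeal (Ultrafilter.compl_mem_iff_notMem.2 h) hA

theorem empty_mem_hindmanIdeal : ∅ ∈ hindmanIdeal := by
  intro B hB h
  obtain ⟨x, hx⟩ := hB.nonempty
  exact h (show x ∈ finiteSums B from ⟨{x}, by simp, by simpa using hx, by simp⟩)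

theorem univ_notMem_hindmanIdeal : Set.univ ∉ hindmanIdeal := fun h =>
  h Set.univ Set.infinite_univ (Set.subset_univ _)

theorem empty_mem_canonicalSummableIdeal : ∅ ∈ canonicalSummableIdeal :=
  mem_canonicalSummableIdeal_iff.2 (by simp)

theorem univ_notMem_canonicalSummableIdeal : Set.univ ∉ canonicalSummableIdeal := fun h =>
  (mem_canonicalSummableIdeal_iff.1 h).ne harmonicMeasure_univ

/-- From `σ` there is a strategy with the single value `v` if `v` is finite, and there are strategies
with sets of values of arbitrarily small harmonic measure if `v = ⊤`. -/
def WinsConstOrSmall (J : LowerSet (Set ℕ)) (φ : List ℕ →. ℕ) (σ : List ℕ) (v : ℕ∞) : Prop :=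
  (∀ c : ℕ, v = c → Wins J φ {c} σ) ∧
    (v = ⊤ → ∀ ε : ℝ≥0∞, ε ≠ 0 → ∃ S, harmonicMeasure S ≤ ε ∧ Wins J φ S σ)

theorem WinsConstOrSmall.exists_wins {v : ℕ∞} (h : WinsConstOrSmall J φ σ v) {ε : ℝ≥0∞}
    (hε : ε ≠ 0) :
    ∃ S, harmonicMeasure S ≤ ε ∧ Wins J φ ({c : ℕ | v = c} ∪ S) σ := by
  by_cases hv : v = ⊤
  · obtain ⟨S, hS, hW⟩ := h.2 hv ε hε
    exact ⟨S, hS, hW.mono Set.subset_union_right⟩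
  · obtain ⟨c, hc⟩ := ENat.ne_top_iff_exists.1 hv
    refine ⟨∅, by simp, (h.1 c hc.symm).mono ?_⟩
    rintro _ rfl
    exact Or.inl hc.symm

/-- The new value is the `q`-limit of the children's values. If it is `⊤`, half of `ε` pays for the
finite values of children over a set of finite sums, and the other half for the small sets of the
children with value `⊤`. -/
theorem exists_winsConstOrSmall {q : Ultrafilter ℕ} (hq : IsFreeIdempotent q)
    (h : ∀ᶠ n in (q : Filter ℕ), ∃ v, WinsConstOrSmall hindmanIdeal φ (σ ++ [n]) v) :
    ∃ v, WinsConstOrSmall hindmanIdeal φ σ v := by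
  classical
  let f : ℕ → ℕ∞ := fun n =>
    if hn : ∃ v, WinsConstOrSmall hindmanIdeal φ (σ ++ [n]) v then hn.choose else ⊤
  have hf : ∀ᶠ n in (q : Filter ℕ), WinsConstOrSmall hindmanIdeal φ (σ ++ [n]) (f n) := by
    filter_upwards [h] with n hn
    simp only [f, dif_pos hn]
    exact hn.choose_spec
  obtain ⟨v, hv⟩ := exists_ultralimit q f
  refine ⟨v, ?_, ?_⟩
  · rintro c rfl
    have hc : ∀ᶠ n in (q : Filter ℕ), f n = c := (hv 0).mono fun n hn => by simpa using hn
    exact .node σ _ (hq.notMem_hindmanIdeal (hf.and hc)) fun n hn => hn.1.1 c hn.2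
  · rintro rfl ε hε
    have hε2 : ε / 2 ≠ 0 := by simpa using hε
    obtain ⟨δ, hδ, hδε⟩ := ENNReal.exists_pos_sum_of_countable' hε2 ℕ
    obtain ⟨B, hB, hBA, hμ⟩ := hq.exists_finiteSums_subset hf f
      (fun N => (hv N).mono fun n hn => hn.elim (fun h => h ▸ ENat.natCast_lt_top N) And.right) hε2
    have hex : ∀ n ∈ finiteSums B, ∃ S, harmonicMeasure S ≤ δ n ∧
        Wins hindmanIdeal φ ({c : ℕ | f n = c} ∪ S) (σ ++ [n]) := fun n hn =>
      (hBA hn).exists_wins (hδ n).ne'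
    choose! S hS hW using hex
    refine ⟨{c : ℕ | ∃ x ∈ finiteSums B, f x = c} ∪ ⋃ n ∈ finiteSums B, S n, ?_,
      .node σ (finiteSums B) (fun h => h B hB subset_rfl) fun n hn => (hW n hn).mono ?_⟩
    · rw [← ENNReal.add_halves ε]
      refine (measure_union_le _ _).trans (add_le_add hμ ?_)
      refine (measure_iUnion_le _).trans ((ENNReal.tsum_le_tsum fun n => ?_).trans hδε.le)
      by_cases hn : n ∈ finiteSums B
      · simpa [hn] using hS n hn
      · simp [hn]
    · exact Set.union_subset_union (fun c hc => ⟨n, hn, hc⟩)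
        (Set.subset_biUnion_of_mem (u := S) hn)

theorem not_lowerLE_canonicalSummableIdeal_hindmanIdeal :
    ¬ LowerLE canonicalSummableIdeal hindmanIdeal := by
  obtain ⟨q, hq, -⟩ := exists_isFreeIdempotent (Set.infinite_univ (α := ℕ))
  refine not_lowerLE_of_bar empty_mem_canonicalSummableIdeal univ_notMem_hindmanIdeal q
    (fun A hA => hq.mem_of_compl_mem_hindmanIdeal hA)
    (fun φ σ => ∃ v, WinsConstOrSmall hindmanIdeal φ σ v) ?_
    (fun φ σ h => exists_winsConstOrSmall hq h) ?_
  · intro φ σ c hc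
    refine ⟨c, fun d hd => .leaf σ c hc ?_, fun h => absurd h (ENat.natCast_ne_top c)⟩
    have : c = d := by exact_mod_cast hd
    exact this
  · rintro φ ⟨v, hv⟩
    obtain ⟨S, hS, hW⟩ := hv.exists_wins one_ne_zero
    refine ⟨_, mem_canonicalSummableIdeal_iff.2 ?_, hW⟩
    have hfin : harmonicMeasure {c : ℕ | v = c} ≤ 1 := by
      induction v with
      | top => simp
      | coe c =>
        calc _ ≤ harmonicMeasure {c} := measure_mono fun d hd => (ENat.natCast_inj.1 hd).symm
          _ ≤ 1 := by simp [harmonicMeasure_singleton]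
    exact (measure_union_le _ _).trans_lt
      (ENNReal.add_lt_top.2 ⟨hfin.trans_lt ENNReal.one_lt_top, hS.trans_lt ENNReal.one_lt_top⟩)

/-! ### The Hindman ideal is not below the summable ideal -/

/-- No translate of `Y` is large for a non-principal idempotent ultrafilter. -/
def IsTranslateSmall (Y : Set ℕ) : Prop :=
  ∀ q : Ultrafilter ℕ, IsFreeIdempotent q → ∀ z, ¬ ∀ᶠ n in (q : Filter ℕ), z + n ∈ Y

theorem IsTranslateSmall.mem_hindmanIdeal {Y : Set ℕ} (hY : IsTranslateSmall Y) :
    Y ∈ hindmanIdeal := by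
  intro B hB hBY
  obtain ⟨q, hq, hqB⟩ := exists_isFreeIdempotent hB
  refine hY q hq 0 ?_
  filter_upwards [hqB] with n hn
  simpa using hBY hn

theorem isTranslateSmall_singleton (c : ℕ) : IsTranslateSmall {c} := by
  intro q hq z h
  obtain ⟨n, hn, hn'⟩ := (h.and (hq.eventually_ne (c - z))).exists
  have : z + n = c := hn
  omega

theorem isTranslateSmall_biUnion_finset {ι : Type*} (F : Finset ι) {Y : ι → Set ℕ}
    (hY : ∀ i ∈ F, IsTranslateSmall (Y i)) : IsTranslateSmall (⋃ i ∈ F, Y i) := by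
  intro q hq z h
  have h' : ∀ᶠ n in (q : Filter ℕ), ∀ i ∈ F, z + n ∉ Y i :=
    (Finset.eventually_all F).2 fun i hi => Ultrafilter.eventually_not.2 (hY i hi q hq z)
  obtain ⟨n, hn, hn'⟩ := (h.and h').exists
  obtain ⟨i, hi, hni⟩ := Set.mem_iUnion₂.1 hn
  exact hn' i hi hni

/-- Non-principal idempotent ultrafilters converge to zero in the 2-adic topology. -/
theorem IsFreeIdempotent.tendsto_padicInt {q : Ultrafilter ℕ} (hq : IsFreeIdempotent q) :
    Tendsto (fun n : ℕ => (n : ℤ_[2])) q (𝓝 0) := by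
  obtain ⟨L, -, hL⟩ := isCompact_univ.ultrafilter_le_nhds
    (q.map fun n : ℕ => (n : ℤ_[2])) (by simp)
  have hL : Tendsto (fun n : ℕ => (n : ℤ_[2])) q (𝓝 L) := hL
  suffices L = 0 by rwa [this] at hL
  -- Addition is continuous and `q + q = q`, so the limit is an additive idempotent.
  have hLL : L + L = L := by
    by_contra hne
    obtain ⟨U, V, hU, hV, hUL, hVL, hUV⟩ := t2_separation hne
    have hc : Tendsto (fun p : ℤ_[2] × ℤ_[2] => p.1 + p.2) (𝓝 L ×ˢ 𝓝 L) (𝓝 (L + L)) := by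
      rw [← nhds_prod_eq]
      exact continuous_add.continuousAt
    have h1 : ∀ᶠ m in (q : Filter ℕ), ∀ᶠ n in (q : Filter ℕ), ((m + n : ℕ) : ℤ_[2]) ∈ U := by
      have := (hc.comp (hL.prodMap hL)).eventually (hU.mem_nhds hUL)
      filter_upwards [this.curry] with m hm
      filter_upwards [hm] with n hn
      rw [Nat.cast_add]
      exact hn
    have h2 := (hq.eventually_iff (P := fun n => (n : ℤ_[2]) ∈ U)).2 h1
    obtain ⟨n, hnU, hnV⟩ := (h2.and (hL.eventually (hV.mem_nhds hVL))).exists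
    exact Set.disjoint_left.1 hUV hnU hnV
  simpa using hLL

/-- A union of translate-small sets that converge 2-adically to a point is translate-small. -/
theorem isTranslateSmall_iUnion {Z : ℕ → Set ℕ} (hZ : ∀ k, IsTranslateSmall (Z k)) {x : ℤ_[2]}
    (hx : ∀ k, ∀ y ∈ Z k, dist (y : ℤ_[2]) x < 1 / ((k : ℝ) + 1)) :
    IsTranslateSmall (⋃ k, Z k) := by
  intro q hq
  have hne : ∀ z : ℕ, (z : ℤ_[2]) ≠ x → ¬ ∀ᶠ n in (q : Filter ℕ), z + n ∈ ⋃ k, Z k := by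
    -- Along `q`, `z + n` tends to `z ≠ x` and so stays away from `x`, where only finitely many `Z
    -- k` can reach it.
    intro z hz h
    have hpos : 0 < dist (z : ℤ_[2]) x := dist_pos.2 hz
    obtain ⟨K, hK⟩ := exists_nat_one_div_lt hpos
    have ht : Tendsto (fun n : ℕ => dist ((z + n : ℕ) : ℤ_[2]) x) q (𝓝 (dist (z : ℤ_[2]) x)) := by
      have := (hq.tendsto_padicInt.const_add (z : ℤ_[2])).dist (tendsto_const_nhds (x := x))
      simpa using this
    refine isTranslateSmall_biUnion_finset (Finset.range K) (fun k _ => hZ k) q hq z ?_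
    filter_upwards [h, ht.eventually (lt_mem_nhds hK)] with n hn hnK
    obtain ⟨k, hk⟩ := Set.mem_iUnion.1 hn
    refine Set.mem_iUnion₂.2 ⟨k, ?_, hk⟩
    rw [Finset.mem_range]
    by_contra! hKk
    have h1 := hx k _ hk
    have h2 : 1 / ((k : ℝ) + 1) ≤ 1 / ((K : ℝ) + 1) := by gcongr
    linarith
  intro z h
  by_cases hz : (z : ℤ_[2]) = x
  · obtain ⟨m, hm, hm0⟩ := ((hq.eventually_iff.1 h).and hq.ne_zero).exists
    refine hne (z + m) (fun hzm => hm0 ?_) (by simpa only [add_assoc] using hm)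
    rw [← hz] at hzm
    simpa using hzm
  · exact hne z hz h

/-- From `σ` there are strategies with translate-small sets of values 2-adically close to `x`. -/
def WinsNear (J : LowerSet (Set ℕ)) (φ : List ℕ →. ℕ) (σ : List ℕ) (x : ℤ_[2]) : Prop :=
  ∀ U ∈ 𝓝 x, ∃ Y : Set ℕ, IsTranslateSmall Y ∧ (∀ y ∈ Y, (y : ℤ_[2]) ∈ U) ∧ Wins J φ Y σ

theorem exists_winsNear {p : Ultrafilter ℕ} (hp : (p : Filter ℕ) ≤ harmonicMeasure.cofinite)
    (h : ∀ᶠ n in (p : Filter ℕ), ∃ x, WinsNear canonicalSummableIdeal φ (σ ++ [n]) x) :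
    ∃ x, WinsNear canonicalSummableIdeal φ σ x := by
  classical
  let f : ℕ → ℤ_[2] := fun n =>
    if hn : ∃ x, WinsNear canonicalSummableIdeal φ (σ ++ [n]) x then hn.choose else 0
  have hf : ∀ᶠ n in (p : Filter ℕ), WinsNear canonicalSummableIdeal φ (σ ++ [n]) (f n) := by
    filter_upwards [h] with n hn
    simp only [f, dif_pos hn]
    exact hn.choose_spec
  obtain ⟨x, -, hx⟩ := isCompact_univ.ultrafilter_le_nhds (p.map f) (by simp)
  have hx : Tendsto f p (𝓝 x) := hx
  refine ⟨x, fun U hU => ?_⟩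
  -- The interior makes `V k` open, hence a neighbourhood of each `f n` in it and not only of `x`.
  let V : ℕ → Set ℤ_[2] := fun k => interior U ∩ Metric.ball x (1 / ((k : ℝ) + 1))
  have hVo : ∀ k, IsOpen (V k) := fun k => isOpen_interior.inter Metric.isOpen_ball
  have hVx : ∀ k, x ∈ V k := fun k =>
    ⟨mem_interior_iff_mem_nhds.2 hU, Metric.mem_ball_self Nat.one_div_pos_of_nat⟩
  have hinf : ∀ A : Set ℕ, A ∈ p → harmonicMeasure A = ∞ := by
    intro A hA
    by_contra hne
    have : Aᶜ ∈ (p : Filter ℕ) := hp (Measure.compl_mem_cofinite.2 (lt_top_iff_ne_top.2 hne))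
    exact Ultrafilter.compl_mem_iff_notMem.1 this hA
  -- Blocks are finite because, within one block, only finite unions are known to preserve
  -- translate-smallness.
  have hblock : ∀ k : ℕ, ∃ F : Finset ℕ, (k : ℝ≥0∞) ≤ harmonicMeasure F ∧ ∀ n ∈ F,
      ∃ Y : Set ℕ, IsTranslateSmall Y ∧ (∀ y ∈ Y, (y : ℤ_[2]) ∈ V k) ∧
        Wins canonicalSummableIdeal φ Y (σ ++ [n]) := by
    intro k
    obtain ⟨F, hF, hFk⟩ := exists_finset_le_harmonicMeasure
      (hinf _ (hf.and (hx.eventually ((hVo k).mem_nhds (hVx k))))) k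
    exact ⟨F, hFk, fun n hn => (hF hn).1 _ ((hVo k).mem_nhds (hF hn).2)⟩
  choose F hFk hF using hblock
  choose! Y hYs hYV hYW using hF
  refine ⟨⋃ k, ⋃ n ∈ F k, Y k n, ?_, ?_, .node σ (⋃ k, (F k : Set ℕ)) ?_ ?_⟩
  · refine isTranslateSmall_iUnion (x := x)
      (fun k => isTranslateSmall_biUnion_finset (F k) (hYs k)) fun k y hy => ?_
    obtain ⟨n, hn, hyn⟩ := Set.mem_iUnion₂.1 hy
    exact (hYV k n hn y hyn).2
  · intro y hy
    obtain ⟨k, hy⟩ := Set.mem_iUnion.1 hy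
    obtain ⟨n, hn, hyn⟩ := Set.mem_iUnion₂.1 hy
    exact interior_subset (hYV k n hn y hyn).1
  · rw [mem_canonicalSummableIdeal_iff, not_lt, top_le_iff]
    refine ENNReal.eq_top_of_forall_nnreal_le fun r => ?_
    obtain ⟨k, hk⟩ := exists_nat_ge r
    calc (r : ℝ≥0∞) ≤ (k : ℝ≥0∞) := by exact_mod_cast hk
      _ ≤ harmonicMeasure (F k) := hFk k
      _ ≤ _ := measure_mono (Set.subset_iUnion (fun k => (F k : Set ℕ)) k)
  · intro n hn
    obtain ⟨k, hk⟩ := Set.mem_iUnion.1 hn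
    refine (hYW k n hk).mono fun y hy => ?_
    exact Set.mem_iUnion.2 ⟨k, Set.mem_iUnion₂.2 ⟨n, hk, hy⟩⟩

theorem not_lowerLE_hindmanIdeal_canonicalSummableIdeal :
    ¬ LowerLE hindmanIdeal canonicalSummableIdeal := by
  have : harmonicMeasure.cofinite.NeBot := by
    rw [← empty_mem_iff_bot.not.trans (neBot_iff.symm), Measure.mem_cofinite]
    simp [harmonicMeasure_univ]
  refine not_lowerLE_of_bar empty_mem_hindmanIdeal univ_notMem_canonicalSummableIdeal
    (Ultrafilter.of harmonicMeasure.cofinite)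
    (fun A hA => Ultrafilter.of_le _ (mem_canonicalSummableIdeal_iff.1 hA))
    (fun φ σ => ∃ x, WinsNear canonicalSummableIdeal φ σ x) ?_
    (fun φ σ h => exists_winsNear (Ultrafilter.of_le _) h) ?_
  · intro φ σ c hc
    refine ⟨c, fun U hU => ⟨{c}, isTranslateSmall_singleton c, ?_, .leaf σ c hc rfl⟩⟩
    rintro _ rfl
    exact mem_of_mem_nhds hU
  · rintro φ ⟨x, hx⟩
    obtain ⟨Y, hY, -, hW⟩ := hx Set.univ univ_mem
    exact ⟨Y, hY.mem_hindmanIdeal, hW⟩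

end GamifiedKatetov

theorem theoremB :
    ¬ GamifiedKatetov.LowerLE GamifiedKatetov.canonicalSummableIdeal GamifiedKatetov.hindmanIdeal ∧
    ¬ GamifiedKatetov.LowerLE GamifiedKatetov.hindmanIdeal GamifiedKatetov.canonicalSummableIdeal :=
  ⟨GamifiedKatetov.not_lowerLE_canonicalSummableIdeal_hindmanIdeal,
    GamifiedKatetov.not_lowerLE_hindmanIdeal_canonicalSummableIdeal⟩
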